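/- Let $V$ and $V'$ be vector spaces (of arbitrary dimension; written here as left vector spaces) over skew fields $K$ and $K'$, and let $\mathcal P(V)$, $\mathcal P(V')$ be the projective spaces whose points are the one-dimensional subspaces of $V$, $V'$. For a mapping $\varphi$ into $\mathcal P(V')$ defined on some subset $\operatorname{dom}\varphi$ of $\mathcal P(V)$, write $\mathcal M^{\varphi}=\{X^{\varphi}\mid X\in\mathcal M\cap\operatorname{dom}\varphi\}$ for $\mathcal M\subset\mathcal P(V)$, and call the points of $\mathcal P(V)\setminus\operatorname{dom}\varphi$ exceptional. Such a $\varphi$ is a linear mapping if (L1) $(\{X\}\vee\{Y\})^{\varphi}=\{X\}^{\varphi}\vee\{Y\}^{\varphi}$ for all points $X\neq Y$ of $\mathcal P(V)$, where $\vee$ denotes the join of subspaces, and (L2) whenever $X^{\varphi}=Y^{\varphi}$ for distinct points $X,Y\in\operatorname{dom}\varphi$, there is at least one exceptional point on the line $\{X\}\vee\{Y\}$. A mapping $f:V\to V'$ is semilinear if it is additive and there is an isomorphism $\zeta:K\to K'$ of skew fields with $f(xv)=\zeta(x)f(v)$ for all $x\in K$, $v\in V$. It induces $\varphi$ if $\operatorname{dom}\varphi=\{Kv\mid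 v\in V,\ f(v)\neq 0\}$ and $(Kv)^{\varphi}=K'f(v)$ for all $v\in V$ with $f(v)\neq0$. Corollary. Let $\varphi$ be a linear mapping from $\mathcal P(V)$ to $\mathcal P(V')$, possibly only partially defined, whose image contains a triangle, i.e. three non-collinear points. Then $\varphi$ is induced by a semilinear mapping $f:V\to V'$, and $f$ is determined to within a non-zero factor in $K'$: a mapping $g:V\to V'$ is semilinear and induces $\varphi$ if and only if there is a $c\in K'\setminus\{0\}$ with $g(v)=c\,f(v)$ for all $v\in V$. -/

import Mathlib

open scoped LinearAlgebra.Projectivization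

namespace ProjGeom

universe u₁ u₂ u₃ u₄

variable {K : Type u₁} {V : Type u₂} {K' : Type u₃} {V' : Type u₄}
  [DivisionRing K] [AddCommGroup V] [Module K V]
  [DivisionRing K'] [AddCommGroup V'] [Module K' V']

/-- The exceptional set of a partially defined mapping: the points where it is not defined. -/
def exceptionalSet (φ : ℙ K V →. ℙ K' V') : Set (ℙ K V) := φ.Domᶜ

/-- The join of two subsets of a projective space, i.e. the join of the subspaces that they span.
Only singletons and empty sets, which are subspaces already, are joined below. -/
def join (S T : Set (ℙ K V)) : Projectivization.Subspace K V :=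
  Projectivization.Subspace.span S ⊔ Projectivization.Subspace.span T

/-- A linear mapping of projective spaces: a partially defined mapping `φ` of points with
(L1) `({X} ∨ {Y})^φ = {X}^φ ∨ {Y}^φ` for all points `X ≠ Y`, where `M^φ` is the set of images
of those points of `M` that are in the domain of `φ`;
(L2) if two distinct points `X`, `Y` of the domain have the same image, then there is
an exceptional point on the line `{X} ∨ {Y}`. -/
structure IsLinearMapping (φ : ℙ K V →. ℙ K' V') : Prop where
  image_join : ∀ X Y : ℙ K V, X ≠ Y →
    φ.image (join {X} {Y} : Projectivization.Subspace K V) =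
      (join (φ.image {X}) (φ.image {Y}) : Projectivization.Subspace K' V')
  exists_exceptional : ∀ X Y : ℙ K V, X ≠ Y → X ∈ φ.Dom → Y ∈ φ.Dom → φ X = φ Y →
    ∃ Z ∈ (join {X} {Y} : Projectivization.Subspace K V), Z ∈ exceptionalSet φ

/-- A set of points contains a triangle, i.e. three non-collinear points. -/
def ContainsTriangle (S : Set (ℙ K V)) : Prop :=
  ∃ A ∈ S, ∃ B ∈ S, ∃ C ∈ S, ¬ Projectivization.IsCollinear ({A, B, C} : Set (ℙ K V))

variable (K K') in
/-- `f : V → V'` is semilinear with respect to some isomorphism `ζ` of `K` onto `K'`. -/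
def IsSemilinear (f : V → V') : Prop :=
  ∃ ζ : K ≃+* K', ∃ F : V →ₛₗ[(ζ : K →+* K')] V', ⇑F = f

/-- `f` induces the partially defined mapping `φ`: the domain of `φ` consists of the points
spanned by vectors `v` with `f v ≠ 0`, and `φ` maps the point spanned by such a `v` to the point
spanned by `f v`. -/
def Induces (f : V → V') (φ : ℙ K V →. ℙ K' V') : Prop :=
  ∀ (v : V) (hv : v ≠ 0) (Q : ℙ K' V'),
    Q ∈ φ (Projectivization.mk K v hv) ↔
      ∃ hfv : f v ≠ 0, Q = Projectivization.mk K' (f v) hfv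

end ProjGeom

/-!
Choose any mapping `p : V → V'` of vectors that induces `φ`. The two axioms of a linear mapping say
that `p` is a *line map* (`IsLineMap`): up to scalars it maps `span {v, w}` onto `span {p v, p w}`,
and `p v`, `p w` are proportional only if `v`, `w` are proportional modulo the zero set of `p`, which
is a subspace. It is never necessary to pass to the quotient by this subspace, since all
independence is tested on the images.

Take `e` with `p e ≠ 0` and a linear form `l` with `l e = 1` that vanishes on the zero set. For `v` in
the hyperplane `ker l`, the point of `p (e + v)` lies on the line joining `p e` to `p v`, so that
`p (e + v)` is proportional to `p e + h v` for a unique multiple `h v` of `p v`. If `p v` and `p w`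
are independent, then the point of `e + v + w` lies on the line joining `e + v` to `w` and on the one
joining `e + w` to `v`, and hence `h (v + w) = h v + h w`
(`IsLineMap.representative_add_of_notMem`); the triangle provides a third vector that reduces the
remaining case to this one. For a scalar `a`, the additive maps `v ↦ h (a • v)` and `h` are pointwise
proportional, and therefore proportional (`exists_eq_smul_of_forall_mem_span`); the factor `ζ a` is a
ring homomorphism in `a`. It is surjective because lines are mapped onto lines. The semilinear map is
`v ↦ ζ (l v) • p e + h (v - l v • e)`.

Uniqueness up to a factor is again `exists_eq_smul_of_forall_mem_span`, because two semilinear maps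
that induce `φ` are pointwise proportional.
-/

namespace ProjGeom

/-! ### Pointwise proportional additive maps -/

section Additive

/-- Two additive maps that agree up to a scalar at every point differ by a single scalar, as soon as
the image of one of them does not lie in the span of one of its values. -/
theorem exists_eq_smul_of_forall_mem_span {A K' V' : Type*} [AddGroup A] [DivisionRing K']
    [AddCommGroup V'] [Module K' V'] {f g : A → V'}
    (hf : ∀ v w, f (v + w) = f v + f w) (hg : ∀ v w, g (v + w) = g v + g w)
    (hfg : ∀ v, ∃ c : K', g v = c • f v)
    (hrange : ∀ v, ∃ x, f x ∉ Submodule.span K' {f v}) :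
    ∃ c : K', ∀ v, g v = c • f v := by
  have f0 : f 0 = 0 := by simpa using hf 0 0
  obtain ⟨x, hx⟩ := hrange 0
  have hx0 : f x ≠ 0 := fun h => hx (by simp [h])
  obtain ⟨c, hc⟩ := hfg x
  have key : ∀ v, f v ∉ Submodule.span K' {f x} → g v = c • f v := by
    intro v hv
    obtain ⟨d, hd⟩ := hfg v
    obtain ⟨k, hk⟩ := hfg (v + x)
    rw [hg, hf, hd, hc, smul_add] at hk
    have e : (d - k) • f v = (k - c) • f x := by
      rw [sub_smul, sub_smul, sub_eq_sub_iff_add_eq_add, hk, add_comm]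
    have hdk : d = k := by
      by_contra hne
      refine hv (Submodule.mem_span_singleton.2 ⟨(d - k)⁻¹ * (k - c), ?_⟩)
      rw [mul_smul, ← e, inv_smul_smul₀ (sub_ne_zero.2 hne)]
    rw [hdk, sub_self, zero_smul, eq_comm, smul_eq_zero, sub_eq_zero] at e
    rw [hd, hdk, e.resolve_right hx0]
  refine ⟨c, fun v => ?_⟩
  by_cases hv : f v ∈ Submodule.span K' {f x}
  · obtain ⟨y, hy⟩ := hrange x
    have hvy : f (v + y) ∉ Submodule.span K' {f x} := by
      rwa [hf, Submodule.add_mem_iff_right _ hv]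
    have := key _ hvy
    rw [hg, hf, key y hy, smul_add] at this
    exact add_right_cancel this
  · exact key v hv

end Additive

/-! ### Mappings of vectors that represent linear mappings -/

section LineMap

variable {K V K' V' : Type*} [DivisionRing K] [AddCommGroup V] [Module K V]
  [DivisionRing K'] [AddCommGroup V'] [Module K' V']

variable (K K') in
/-- A map of vectors that represents a linear mapping of projective spaces: up to scalars, it maps
the span of two vectors onto the span of their images, and vectors with proportional images are
proportional modulo the zero set. The vectors mapped to zero represent the exceptional points. No
compatibility with sums or scalars beyond this is required, so `p v` matters only up to a scalar. -/
structure IsLineMap (p : V → V') : Prop where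
  mem_span : ∀ v w, ∀ u ∈ Submodule.span K {v, w}, p u ∈ Submodule.span K' {p v, p w}
  exists_preimage : ∀ v w, ∀ z ∈ Submodule.span K' {p v, p w},
    ∃ u ∈ Submodule.span K {v, w}, ∃ t : K', t ≠ 0 ∧ p u = t • z
  exists_sub_eq_zero : ∀ v w, ∀ t : K', p v = t • p w → ∃ c : K, p (v - c • w) = 0

namespace IsLineMap

variable {p : V → V'}

theorem map_smul_mem_span (hp : IsLineMap K K' p) (a : K) (v : V) :
    p (a • v) ∈ Submodule.span K' {p v} := by
  simpa using hp.mem_span v v (a • v) (Submodule.mem_span_pair.2 ⟨a, 0, by simp⟩)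

theorem map_add_mem_span (hp : IsLineMap K K' p) (v w : V) :
    p (v + w) ∈ Submodule.span K' {p v, p w} :=
  hp.mem_span v w _ (Submodule.mem_span_pair.2 ⟨1, 1, by simp⟩)

theorem exists_map_smul (hp : IsLineMap K K' p) {a : K} (ha : a ≠ 0) {v : V} (hv : p v ≠ 0) :
    ∃ t : K', t ≠ 0 ∧ p (a • v) = t • p v := by
  obtain ⟨t, ht⟩ := Submodule.mem_span_singleton.1 (hp.map_smul_mem_span a v)
  refine ⟨t, ?_, ht.symm⟩
  rintro rfl
  have h := hp.map_smul_mem_span a⁻¹ (a • v)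
  rw [inv_smul_smul₀ ha, ← ht, zero_smul, Submodule.span_zero_singleton, Submodule.mem_bot] at h
  exact hv h

/-- The subspace of vectors that represent exceptional points. -/
def ker (hp : IsLineMap K K' p) (h0 : p 0 = 0) : Submodule K V where
  carrier := {v | p v = 0}
  zero_mem' := h0
  add_mem' {v w} hv hw := by
    have h := hp.map_add_mem_span v w
    rw [Set.mem_ofPred_eq] at hv hw
    simpa [hv, hw] using h
  smul_mem' a v hv := by
    have h := hp.map_smul_mem_span a v
    rw [Set.mem_ofPred_eq] at hv
    simpa [hv] using h

/-! ### The additive map on a hyperplane -/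

section Hyperplane

variable {e : V} {l : V →ₗ[K] K}

/-- The image of `e` lies on no line spanned by images of vectors of the hyperplane. -/
theorem coeff_eq_zero (hp : IsLineMap K K' p) (hl : ∀ v, p v = 0 → l v = 0) (he : l e = 1)
    {v w : V} (hv : l v = 0) (hw : l w = 0) {a : K'}
    (h : a • p e ∈ Submodule.span K' {p v, p w}) : a = 0 := by
  obtain ⟨u, hu, t, ht, hut⟩ := hp.exists_preimage v w _ h
  have hlu : l u = 0 := by
    obtain ⟨b, c, rfl⟩ := Submodule.mem_span_pair.1 hu
    simp [hv, hw]
  rw [smul_smul] at hut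
  obtain ⟨c, hc⟩ := hp.exists_sub_eq_zero u e _ hut
  have hc' := hl _ hc
  rw [map_sub, map_smul, hlu, he, smul_eq_mul, mul_one, zero_sub, neg_eq_zero] at hc'
  rw [hc', zero_smul, sub_zero, hut, smul_eq_zero, mul_eq_zero] at hc
  have hpe : p e ≠ 0 := fun h0 => one_ne_zero (he ▸ hl e h0)
  exact (hc.resolve_right hpe).resolve_left ht

/-- Coefficients of `p e` can be compared modulo a line spanned by images of vectors of the
hyperplane. -/
theorem coeff_eq_coeff (hp : IsLineMap K K' p) (hl : ∀ v, p v = 0 → l v = 0) (he : l e = 1)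
    {v w : V} (hv : l v = 0) (hw : l w = 0) {a b : K'} {y z : V'}
    (hy : y ∈ Submodule.span K' {p v, p w}) (hz : z ∈ Submodule.span K' {p v, p w})
    (h : a • p e + y = b • p e + z) : a = b ∧ y = z := by
  have hab : a - b = 0 := by
    refine hp.coeff_eq_zero hl he hv hw (?_ : (a - b) • p e ∈ Submodule.span K' {p v, p w})
    have : (a - b) • p e = z - y := by
      rw [sub_smul, sub_eq_sub_iff_add_eq_add, h, add_comm]
    rw [this]
    exact sub_mem hz hy
  rw [sub_eq_zero] at hab
  subst hab
  exact ⟨rfl, add_left_cancel h⟩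

/-- The image of `e + v` selects one vector on the line spanned by `p v`. -/
theorem exists_representative (hp : IsLineMap K K' p) (hl : ∀ v, p v = 0 → l v = 0) (he : l e = 1)
    {v : V} (hv : l v = 0) :
    ∃ z ∈ Submodule.span K' {p v}, ∃ t : K', t ≠ 0 ∧ p (e + v) = t • (p e + z) := by
  obtain ⟨c, d, hcd⟩ := Submodule.mem_span_pair.1 (hp.map_add_mem_span e v)
  have hc : c ≠ 0 := by
    rintro rfl
    rw [zero_smul, zero_add] at hcd
    obtain ⟨a, ha⟩ := hp.exists_sub_eq_zero _ v d hcd.symm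
    simpa [he, hv] using hl _ ha
  refine ⟨(c⁻¹ * d) • p v, Submodule.mem_span_singleton.2 ⟨_, rfl⟩, c, hc, ?_⟩
  rw [smul_add, smul_smul, mul_inv_cancel_left₀ hc, hcd]

variable {h : LinearMap.ker l → V'}

/-- A representative spans the same line as `p v`, and vanishes only together with it. -/
theorem exists_representative_eq_smul (hp : IsLineMap K K' p) (hl : ∀ v, p v = 0 → l v = 0)
    (he : l e = 1) (hmem : ∀ v : LinearMap.ker l, h v ∈ Submodule.span K' {p v})
    (hadd : ∀ v : LinearMap.ker l, ∃ t : K', t ≠ 0 ∧ p (e + v) = t • (p e + h v))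
    (v : LinearMap.ker l) : ∃ s : K', s ≠ 0 ∧ h v = s • p v := by
  obtain ⟨s, hs⟩ := Submodule.mem_span_singleton.1 (hmem v)
  by_cases hv : p v = 0
  · exact ⟨1, one_ne_zero, by rw [← hs, hv, smul_zero, smul_zero]⟩
  refine ⟨s, ?_, hs.symm⟩
  rintro rfl
  rw [zero_smul] at hs
  obtain ⟨t, ht, h1⟩ := hadd v
  rw [← hs, add_zero] at h1
  obtain ⟨c, hc⟩ := hp.exists_sub_eq_zero _ _ _ h1
  have := hl _ hc
  rw [map_sub, map_add, map_smul, he, LinearMap.mem_ker.1 v.2, add_zero, smul_eq_mul, mul_one,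
    sub_eq_zero] at this
  rw [← this, one_smul, add_sub_cancel_left] at hc
  exact hv hc

/-- Additivity of the representatives if `p w` is not a multiple of `p v`: the point of `e + v + w`
lies on the lines joining `e + v` to `w` and `e + w` to `v`. -/
theorem representative_add_of_notMem (hp : IsLineMap K K' p) (hl : ∀ v, p v = 0 → l v = 0)
    (he : l e = 1) (hmem : ∀ v : LinearMap.ker l, h v ∈ Submodule.span K' {p v})
    (hadd : ∀ v : LinearMap.ker l, ∃ t : K', t ≠ 0 ∧ p (e + v) = t • (p e + h v))
    (v w : LinearMap.ker l) (hvw : p w ∉ Submodule.span K' {p v}) :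
    h (v + w) = h v + h w := by
  have hlv := LinearMap.mem_ker.1 v.2
  have hlw := LinearMap.mem_ker.1 w.2
  have hvS : h v ∈ Submodule.span K' {p v, p w} :=
    Submodule.span_mono (by simp) (hmem v)
  have hwS : h w ∈ Submodule.span K' {p v, p w} :=
    Submodule.span_mono (by simp) (hmem w)
  have hsS : h (v + w) ∈ Submodule.span K' {p v, p w} := by
    refine (Submodule.span_singleton_le_iff_mem _ _).2 ?_ (hmem (v + w))
    exact hp.map_add_mem_span v w
  obtain ⟨k, hk, hks⟩ := hadd (v + w)
  obtain ⟨t, -, hts⟩ := hadd v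
  obtain ⟨s, -, hss⟩ := hadd w
  obtain ⟨r₁, -, hr₁⟩ := hp.exists_representative_eq_smul hl he hmem hadd v
  obtain ⟨r₂, -, hr₂⟩ := hp.exists_representative_eq_smul hl he hmem hadd w
  have h1 := hp.map_add_mem_span (e + v) w
  have h2 := hp.map_add_mem_span (e + w) v
  obtain ⟨a, b, h1⟩ := Submodule.mem_span_pair.1 h1
  obtain ⟨c, d, h2⟩ := Submodule.mem_span_pair.1 h2
  rw [Submodule.coe_add, ← add_assoc] at hks
  rw [hts, hks, smul_smul, smul_add, smul_add, add_assoc] at h1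
  rw [add_right_comm, hss, hks, smul_smul, smul_add, smul_add, add_assoc] at h2
  have hpv : p v ∈ Submodule.span K' {p (v : V), p (w : V)} := Submodule.subset_span (by simp)
  have hpw : p w ∈ Submodule.span K' {p (v : V), p (w : V)} := Submodule.subset_span (by simp)
  obtain ⟨e1, e2⟩ := hp.coeff_eq_coeff hl he hlv hlw
    (add_mem (Submodule.smul_mem _ _ hvS) (Submodule.smul_mem _ _ hpw))
    (Submodule.smul_mem _ _ hsS) h1
  obtain ⟨e3, e4⟩ := hp.coeff_eq_coeff hl he hlv hlw
    (add_mem (Submodule.smul_mem _ _ hwS) (Submodule.smul_mem _ _ hpv))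
    (Submodule.smul_mem _ _ hsS) h2
  rw [e1] at e2
  rw [e3] at e4
  -- compare the coefficients of `p w`
  have e5 : (k * r₂ - b) • p w = (k * r₁ - d) • p v := by
    rw [hr₁] at e2
    rw [hr₂] at e4
    rw [sub_smul, sub_smul, mul_smul, mul_smul, sub_eq_sub_iff_add_eq_add, e4, ← e2]
  have hb : b = k * r₂ := by
    by_contra hne
    refine hvw (Submodule.mem_span_singleton.2 ⟨(k * r₂ - b)⁻¹ * (k * r₁ - d), ?_⟩)
    rw [mul_smul, ← e5, inv_smul_smul₀ (sub_ne_zero.2 (Ne.symm hne))]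
  rw [hb, mul_smul, ← hr₂, ← smul_add] at e2
  exact (smul_right_injective V' hk e2).symm

/-- Some vector of the hyperplane has its image off the line of `p v`: project one whose image is off
the line joining `p e` to `p v`. -/
theorem exists_mem_ker_notMem_span (hp : IsLineMap K K' p) (he : l e = 1)
    (htri : ∀ v w, ∃ x, p x ∉ Submodule.span K' {p v, p w}) (v : V) :
    ∃ x : LinearMap.ker l, p x ∉ Submodule.span K' {p v} := by
  obtain ⟨y, hy⟩ := htri e v
  refine ⟨⟨y - l y • e, by simp [he]⟩, fun hx => hy ?_⟩
  have h1 := hp.mem_span (y - l y • e) e y (Submodule.mem_span_pair.2 ⟨1, l y, by simp⟩)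
  refine Submodule.span_le.2 ?_ h1
  rintro z (rfl | rfl)
  · exact Submodule.span_mono (by simp) hx
  · exact Submodule.subset_span (by simp)

/-- Additivity of the representatives on the whole hyperplane. -/
theorem representative_add (hp : IsLineMap K K' p) (hl : ∀ v, p v = 0 → l v = 0)
    (he : l e = 1) (htri : ∀ v w, ∃ x, p x ∉ Submodule.span K' {p v, p w})
    (hmem : ∀ v : LinearMap.ker l, h v ∈ Submodule.span K' {p v})
    (hadd : ∀ v : LinearMap.ker l, ∃ t : K', t ≠ 0 ∧ p (e + v) = t • (p e + h v))
    (v w : LinearMap.ker l) : h (v + w) = h v + h w := by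
  have key := hp.representative_add_of_notMem hl he hmem hadd
  by_cases hw : p w ∈ Submodule.span K' {p (v : V)}
  · obtain ⟨x, hx⟩ := hp.exists_mem_ker_notMem_span he htri v
    -- translate by a vector `x` whose image is off the common line of `p v` and `p w`
    have hvw : p (v + w : V) ∈ Submodule.span K' {p (v : V)} := by
      refine Submodule.span_le.2 ?_ (hp.map_add_mem_span v w)
      rintro z (rfl | rfl)
      · exact Submodule.mem_span_singleton_self _
      · exact hw
    have hwx : p (w + x : V) ∉ Submodule.span K' {p (v : V)} := by
      intro hcon
      refine hx (Submodule.span_le.2 ?_ (hp.mem_span (w + x) w x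
        (Submodule.mem_span_pair.2 ⟨1, -1, by simp⟩)))
      rintro z (rfl | rfl)
      · exact hcon
      · exact hw
    have e1 := key (v + w) x fun hcon => hx <|
      (Submodule.span_singleton_le_iff_mem _ _).2 hvw hcon
    have e2 := key v (w + x) hwx
    have e3 := key w x fun hcon => hx <|
      (Submodule.span_singleton_le_iff_mem _ _).2 hw hcon
    rw [← add_assoc, e1, e3, ← add_assoc] at e2
    exact add_right_cancel e2
  · exact key v w hw

end Hyperplane

/-! ### The accompanying isomorphism and the semilinear map -/

/-- A line map whose image is not contained in the span of two of its values agrees with a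
semilinear map up to scalars. -/
theorem exists_semilinear (hp : IsLineMap K K' p) (h0 : p 0 = 0)
    (htri : ∀ v w, ∃ x, p x ∉ Submodule.span K' {p v, p w}) :
    ∃ f : V → V', IsSemilinear K K' f ∧ ∀ v, ∃ t : K', t ≠ 0 ∧ p v = t • f v := by
  obtain ⟨e₀, he₀⟩ := htri 0 0
  have he₀' : e₀ ∉ hp.ker h0 := fun h => he₀ (by rw [show p e₀ = 0 from h]; exact zero_mem _)
  obtain ⟨l₀, hl₀, hker⟩ := Submodule.exists_le_ker_of_notMem he₀'
  -- rescale `e₀` so that the functional takes the value one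
  obtain ⟨e, l, he, hl⟩ : ∃ (e : V) (l : V →ₗ[K] K), l e = 1 ∧ ∀ v, p v = 0 → l v = 0 :=
    ⟨(l₀ e₀)⁻¹ • e₀, l₀, by simp [hl₀], fun v hv => hker hv⟩
  have hex : ∀ v : LinearMap.ker l, ∃ z ∈ Submodule.span K' {p (v : V)},
      ∃ t : K', t ≠ 0 ∧ p (e + v) = t • (p e + z) :=
    fun v => hp.exists_representative hl he v.2
  choose h hmem hadd using hex
  have hh : ∀ v w, h (v + w) = h v + h w := hp.representative_add hl he htri hmem hadd
  have hspan := hp.exists_representative_eq_smul hl he hmem hadd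
  have hrange : ∀ v, ∃ x, h x ∉ Submodule.span K' {h v} := by
    intro v
    obtain ⟨x, hx⟩ := hp.exists_mem_ker_notMem_span he htri v
    refine ⟨x, fun hcon => hx ?_⟩
    obtain ⟨s, hs, hsx⟩ := hspan x
    have := (Submodule.span_singleton_le_iff_mem _ _).2 (hmem v) hcon
    rw [hsx] at this
    exact (Submodule.smul_mem_iff _ hs).1 this
  have hζ : ∀ a : K, ∃ c : K', ∀ v, h (a • v) = c • h v := by
    intro a
    refine exists_eq_smul_of_forall_mem_span (f := h) (g := fun v => h (a • v)) hh
      (fun v w => by rw [smul_add, hh]) (fun v => ?_) hrange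
    obtain ⟨s, hs, hsv⟩ := hspan v
    obtain ⟨c, hc⟩ := Submodule.mem_span_singleton.1
      ((Submodule.span_singleton_le_iff_mem _ _).2 (hp.map_smul_mem_span a v) (hmem (a • v)))
    exact ⟨c * s⁻¹, by rw [← hc, hsv, mul_smul, inv_smul_smul₀ hs]⟩
  choose ζ hζ using hζ
  -- evaluating at one vector with `h x ≠ 0` shows that `ζ` is a ring homomorphism
  have hh0 : h 0 = 0 := by simpa using hh 0 0
  obtain ⟨x, hx⟩ := hrange 0
  have hx0 : h x ≠ 0 := fun h' => hx (by simp [h'])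
  have hcancel : ∀ {c d : K'}, c • h x = d • h x → c = d :=
    fun hcd => smul_left_injective K' hx0 hcd
  let Z : K →+* K' :=
    { toFun := ζ
      map_one' := hcancel (by rw [← hζ, one_smul, one_smul])
      map_zero' := hcancel (by rw [← hζ, zero_smul, zero_smul, hh0])
      map_mul' := fun a b => hcancel (by rw [← hζ, mul_smul, hζ, hζ, mul_smul])
      map_add' := fun a b => hcancel (by rw [← hζ, add_smul, hh, hζ, hζ, add_smul]) }
  let π : V →ₗ[K] LinearMap.ker l :=
    LinearMap.codRestrict _ (LinearMap.id - l.smulRight e) (by simp [he])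
  have hπ : ∀ v, l v • e + (π v : V) = v := fun v =>
    add_sub_cancel (l v • e) v
  let F : V →ₛₗ[Z] V' :=
    { toFun := fun v => Z (l v) • p e + h (π v)
      map_add' := fun v w => by
        simp only [map_add, add_smul, hh]
        abel
      map_smul' := fun a v => by
        rw [π.map_smul, l.map_smul, hζ, smul_eq_mul, map_mul, mul_smul, smul_add]
        rfl }
  have hF : ∀ v, F v = Z (l v) • p e + h (π v) := fun v => rfl
  have hpF : ∀ v, ∃ t : K', t ≠ 0 ∧ p v = t • F v := by
    intro v
    by_cases hv : l v = 0
    · have hπv : (π v : V) = v := by simpa [hv] using hπ v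
      obtain ⟨s, hs, hsv⟩ := hspan (π v)
      refine ⟨s⁻¹, inv_ne_zero hs, ?_⟩
      rw [hF, hv, map_zero, zero_smul, zero_add, hsv, hπv, inv_smul_smul₀ hs]
    · obtain ⟨t, ht, htv⟩ := hadd ((l v)⁻¹ • π v)
      have hne : p (e + ((l v)⁻¹ • π v : LinearMap.ker l)) ≠ 0 := fun hcon => by
        simpa [he] using hl _ hcon
      obtain ⟨s, hs, hsv⟩ := hp.exists_map_smul hv hne
      rw [Submodule.coe_smul, smul_add, smul_inv_smul₀ hv, hπ] at hsv
      refine ⟨s * t * (Z (l v))⁻¹, by simp [hs, ht, hv], ?_⟩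
      have hZ : Z (l v) ≠ 0 := by simp [hv]
      have h1 : h ((l v)⁻¹ • π v) = (Z (l v))⁻¹ • h (π v) := by
        rw [hζ, ← map_inv₀ Z]; rfl
      rw [Submodule.coe_smul] at htv
      rw [hsv, htv, h1, hF, mul_smul _ (Z (l v))⁻¹, smul_add (Z (l v))⁻¹, inv_smul_smul₀ hZ,
        mul_smul]
  -- lines are mapped onto lines, which makes `Z` surjective
  have hsurj : Function.Surjective Z := by
    intro c
    have hlx := LinearMap.mem_ker.1 x.2
    obtain ⟨r, hr, hrx⟩ := hspan x
    -- a preimage of the point of `p e + c • h x` on the line joining `e` to `x`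
    obtain ⟨u, hu, t, ht, hut⟩ := hp.exists_preimage e x (p e + c • h x)
      (Submodule.mem_span_pair.2 ⟨1, c * r, by rw [hrx, one_smul, mul_smul]⟩)
    obtain ⟨a, b, rfl⟩ := Submodule.mem_span_pair.1 hu
    obtain ⟨s, hs, hsu⟩ := hpF (a • e + b • (x : V))
    have hFu : F (a • e + b • (x : V)) = Z a • p e + Z b • h x := by
      have hl' : l (a • e + b • (x : V)) = a := by simp [he, hlx]
      have hπ' : π (a • e + b • (x : V)) = b • x := by
        apply Subtype.ext
        have := hπ (a • e + b • (x : V))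
        rw [hl'] at this
        exact add_left_cancel this
      rw [hF, hl', hπ', hζ]
      rfl
    have hxS : h x ∈ Submodule.span K' {p (x : V), p (x : V)} := by simpa using hmem x
    rw [hut, hFu, smul_add, smul_add, smul_smul, smul_smul, smul_smul] at hsu
    obtain ⟨e1, e2⟩ := hp.coeff_eq_coeff hl he hlx hlx
      (Submodule.smul_mem _ _ hxS) (Submodule.smul_mem _ _ hxS) hsu
    have e2 := hcancel e2
    have hZa : Z a ≠ 0 := fun h' => ht (by rw [e1, h', mul_zero])
    refine ⟨a⁻¹ * b, ?_⟩
    rw [e1, mul_assoc] at e2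
    rw [map_mul, map_inv₀, ← mul_left_cancel₀ hs e2, inv_mul_cancel_left₀ hZa]
  exact ⟨F, ⟨RingEquiv.ofBijective Z ⟨Z.injective, hsurj⟩, F, rfl⟩, hpF⟩

end IsLineMap

end LineMap

/-! ### From mappings of points to mappings of vectors -/

section Coordinates

variable {K V K' V' : Type*} [DivisionRing K] [AddCommGroup V] [Module K V]
  [DivisionRing K'] [AddCommGroup V'] [Module K' V']

theorem submodule_span_mk (v : V) (hv : v ≠ 0) :
    Projectivization.Subspace.submodule (Projectivization.Subspace.span {Projectivization.mk K v hv})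
      = Submodule.span K {v} := by
  apply le_antisymm
  · rw [← OrderIso.le_symm_apply, Projectivization.Subspace.span_le_subspace_iff]
    rintro _ rfl
    exact (Submodule.mk_mem_projectivization_iff _ hv).2 (Submodule.mem_span_singleton_self v)
  · rw [Submodule.span_singleton_le_iff_mem, Projectivization.Subspace.mem_submodule_iff _ hv]
    exact Projectivization.Subspace.subset_span _ rfl

theorem mk_mem_join_iff {v w u : V} (hv : v ≠ 0) (hw : w ≠ 0) (hu : u ≠ 0) :
    Projectivization.mk K u hu ∈ join {Projectivization.mk K v hv} {Projectivization.mk K w hw} ↔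
      u ∈ Submodule.span K {v, w} := by
  rw [← Projectivization.Subspace.mem_submodule_iff _ hu, join, OrderIso.map_sup,
    submodule_span_mk, submodule_span_mk, ← Submodule.span_union, Set.singleton_union]

/-- Every partially defined mapping of points is induced by some mapping of vectors. -/
theorem exists_induces (φ : ℙ K V →. ℙ K' V') : ∃ p : V → V', p 0 = 0 ∧ Induces p φ := by
  classical
  refine ⟨fun v => if h : ∃ hv : v ≠ 0, (φ (Projectivization.mk K v hv)).Dom then
    ((φ (Projectivization.mk K v h.1)).get h.2).rep else 0, by simp, fun v hv Q => ?_⟩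
  by_cases h : (φ (Projectivization.mk K v hv)).Dom
  · have h' : ∃ hv : v ≠ 0, (φ (Projectivization.mk K v hv)).Dom := ⟨hv, h⟩
    simp only [dif_pos h', Projectivization.mk_rep]
    constructor
    · exact fun hQ => ⟨Projectivization.rep_nonzero _, (Part.get_eq_of_mem hQ h).symm⟩
    · rintro ⟨-, rfl⟩
      exact Part.get_mem h
  · have h' : ¬ ∃ hv : v ≠ 0, (φ (Projectivization.mk K v hv)).Dom := fun ⟨_, h2⟩ => h h2
    simp only [dif_neg h']
    exact ⟨fun hQ => (h (Part.dom_iff_mem.2 ⟨Q, hQ⟩)).elim, fun ⟨h2, _⟩ => (h2 rfl).elim⟩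

namespace Induces

variable {φ : ℙ K V →. ℙ K' V'} {p : V → V'}

theorem mem_dom_iff (hpφ : Induces p φ) {v : V} (hv : v ≠ 0) :
    Projectivization.mk K v hv ∈ φ.Dom ↔ p v ≠ 0 := by
  rw [PFun.mem_dom]
  exact ⟨fun ⟨Q, hQ⟩ => ((hpφ v hv Q).1 hQ).1, fun h => ⟨_, (hpφ v hv _).2 ⟨h, rfl⟩⟩⟩

theorem submodule_span_image (hpφ : Induces p φ) {v : V} (hv : v ≠ 0) :
    Projectivization.Subspace.submodule
      (Projectivization.Subspace.span (φ.image {Projectivization.mk K v hv})) =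
      Submodule.span K' {p v} := by
  by_cases h : p v = 0
  · have : φ.image {Projectivization.mk K v hv} = ∅ := by
      refine Set.eq_empty_of_forall_notMem fun Q hQ => ?_
      obtain ⟨_, rfl, hQ⟩ := hQ
      exact ((hpφ v hv Q).1 hQ).1 h
    rw [this, Projectivization.Subspace.span_empty, OrderIso.map_bot, h,
      Submodule.span_zero_singleton]
  · have : φ.image {Projectivization.mk K v hv} = {Projectivization.mk K' (p v) h} := by
      ext Q
      constructor
      · rintro ⟨_, rfl, hQ⟩
        exact ((hpφ v hv Q).1 hQ).2
      · rintro rfl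
        exact ⟨_, rfl, (hpφ v hv _).2 ⟨h, rfl⟩⟩
    rw [this, submodule_span_mk]

theorem mk_mem_join_image_iff (hpφ : Induces p φ) {v w : V} (hv : v ≠ 0) (hw : w ≠ 0)
    {z : V'} (hz : z ≠ 0) :
    Projectivization.mk K' z hz ∈ join (φ.image {Projectivization.mk K v hv})
      (φ.image {Projectivization.mk K w hw}) ↔ z ∈ Submodule.span K' {p v, p w} := by
  rw [← Projectivization.Subspace.mem_submodule_iff _ hz, join, OrderIso.map_sup,
    hpφ.submodule_span_image, hpφ.submodule_span_image, ← Submodule.span_union,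
    Set.singleton_union]

theorem map_smul (hpφ : Induces p φ) (h0 : p 0 = 0) (a : K) (v : V) :
    p (a • v) ∈ Submodule.span K' {p v} := by
  by_cases hav : p (a • v) = 0
  · rw [hav]
    exact zero_mem _
  have hne : a • v ≠ 0 := fun h => hav (h ▸ h0)
  have hv : v ≠ 0 := right_ne_zero_of_smul hne
  have h1 := (hpφ _ hne _).2 ⟨hav, rfl⟩
  rw [show Projectivization.mk K (a • v) hne = Projectivization.mk K v hv from
    (Projectivization.mk_eq_mk_iff' K _ _ _ _).2 ⟨a, rfl⟩, hpφ v hv] at h1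
  obtain ⟨hpv, h2⟩ := h1
  exact Submodule.mem_span_singleton.2 ((Projectivization.mk_eq_mk_iff' K' _ _ _ _).1 h2)

/-- A mapping of vectors that induces a linear mapping of points is a line map. The two axioms speak
of distinct points only; for proportional vectors the claims follow from homogeneity. -/
theorem isLineMap (hpφ : Induces p φ) (hφ : IsLinearMapping φ) (h0 : p 0 = 0) :
    IsLineMap K K' p := by
  -- the join axiom, for vectors that span distinct points
  have image_iff : ∀ {v w : V} (hv : v ≠ 0) (hw : w ≠ 0),
      Projectivization.mk K v hv ≠ Projectivization.mk K w hw → ∀ {z : V'} (hz : z ≠ 0),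
      (z ∈ Submodule.span K' {p v, p w} ↔ ∃ u ∈ Submodule.span K {v, w}, ∃ hu : u ≠ 0,
        Projectivization.mk K' z hz ∈ φ (Projectivization.mk K u hu)) := by
    intro v w hv hw hne z hz
    rw [← hpφ.mk_mem_join_image_iff hv hw hz, ← SetLike.mem_coe, ← hφ.image_join _ _ hne]
    constructor
    · rintro ⟨X, hX, hzX⟩
      induction X using Projectivization.ind with | h u hu =>
      exact ⟨u, (mk_mem_join_iff hv hw hu).1 hX, hu, hzX⟩
    · rintro ⟨u, hu, hu0, hzu⟩
      exact ⟨_, (mk_mem_join_iff hv hw hu0).2 hu, hzu⟩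
  have dependent : ∀ {v w : V}, (∀ (hv : v ≠ 0) (hw : w ≠ 0),
      Projectivization.mk K v hv = Projectivization.mk K w hw) →
      (∃ c : K, v = c • w) ∨ w = 0 := by
    intro v w h
    by_cases hv : v = 0
    · exact Or.inl ⟨0, by simp [hv]⟩
    by_cases hw : w = 0
    · exact Or.inr hw
    obtain ⟨c, hc⟩ := (Projectivization.mk_eq_mk_iff' K _ _ _ _).1 (h hv hw)
    exact Or.inl ⟨c, hc.symm⟩
  have span_le : ∀ {v w : V} {c : K}, v = c • w →
      Submodule.span K {v, w} = Submodule.span K {w} := by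
    rintro v w c rfl
    exact Submodule.span_insert_eq_span
      (Submodule.smul_mem _ _ (Submodule.mem_span_singleton_self w))
  refine ⟨fun v w u hu => ?_, fun v w z hz => ?_, fun v w t hvw => ?_⟩
  · by_cases hpu : p u = 0
    · rw [hpu]
      exact zero_mem _
    have hu0 : u ≠ 0 := fun h => hpu (h ▸ h0)
    by_cases hd : ∀ (hv : v ≠ 0) (hw : w ≠ 0),
      Projectivization.mk K v hv = Projectivization.mk K w hw
    · rcases dependent hd with ⟨c, hc⟩ | rfl
      · rw [span_le hc] at hu
        obtain ⟨a, rfl⟩ := Submodule.mem_span_singleton.1 hu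
        exact Submodule.span_mono (by simp) (hpφ.map_smul h0 a w)
      · obtain ⟨a, b, rfl⟩ := Submodule.mem_span_pair.1 hu
        rw [smul_zero, add_zero]
        exact Submodule.span_mono (by simp) (hpφ.map_smul h0 a v)
    · push Not at hd
      obtain ⟨hv, hw, hne⟩ := hd
      exact (image_iff hv hw hne hpu).2 ⟨u, hu, hu0, (hpφ u hu0 _).2 ⟨hpu, rfl⟩⟩
  · by_cases hz0 : z = 0
    · exact ⟨0, zero_mem _, 1, one_ne_zero, by rw [h0, hz0, smul_zero]⟩
    have proportional : ∀ x ∈ Submodule.span K {v, w}, z ∈ Submodule.span K' {p x} →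
        ∃ u ∈ Submodule.span K {v, w}, ∃ t : K', t ≠ 0 ∧ p u = t • z := by
      intro x hx hzx
      obtain ⟨s, hs⟩ := Submodule.mem_span_singleton.1 hzx
      have hs0 : s ≠ 0 := fun h => hz0 (by rw [← hs, h, zero_smul])
      exact ⟨x, hx, s⁻¹, inv_ne_zero hs0, by rw [← hs, inv_smul_smul₀ hs0]⟩
    by_cases hd : ∀ (hv : v ≠ 0) (hw : w ≠ 0),
      Projectivization.mk K v hv = Projectivization.mk K w hw
    · rcases dependent hd with ⟨c, rfl⟩ | rfl
      · refine proportional w (Submodule.subset_span (by simp)) ?_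
        rwa [Submodule.span_insert_eq_span (hpφ.map_smul h0 c w)] at hz
      · refine proportional v (Submodule.subset_span (by simp)) ?_
        rwa [h0, Set.pair_comm, Submodule.span_insert_eq_span (zero_mem _)] at hz
    · push Not at hd
      obtain ⟨hv, hw, hne⟩ := hd
      obtain ⟨u, hu, hu0, hzu⟩ := (image_iff hv hw hne hz0).1 hz
      obtain ⟨hpu, he⟩ := (hpφ u hu0 _).1 hzu
      exact proportional u hu
        (Submodule.mem_span_singleton.2 ((Projectivization.mk_eq_mk_iff' K' _ _ _ _).1 he))
  · by_cases hpv : p v = 0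
    · exact ⟨0, by rw [zero_smul, sub_zero, hpv]⟩
    have hpw : p w ≠ 0 := fun h => hpv (by rw [hvw, h, smul_zero])
    have hv : v ≠ 0 := fun h => hpv (h ▸ h0)
    have hw : w ≠ 0 := fun h => hpw (h ▸ h0)
    by_cases hd : Projectivization.mk K v hv = Projectivization.mk K w hw
    · obtain ⟨c, hc⟩ := (Projectivization.mk_eq_mk_iff' K _ _ _ _).1 hd
      exact ⟨c, by rw [hc, sub_self, h0]⟩
    have heq : φ (Projectivization.mk K v hv) = φ (Projectivization.mk K w hw) := by
      have hmk : Projectivization.mk K' (p v) hpv = Projectivization.mk K' (p w) hpw :=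
        (Projectivization.mk_eq_mk_iff' K' _ _ _ _).2 ⟨t, hvw.symm⟩
      refine Part.ext fun Q => ?_
      rw [hpφ v hv, hpφ w hw]
      exact ⟨fun ⟨_, h⟩ => ⟨hpw, h.trans hmk⟩, fun ⟨_, h⟩ => ⟨hpv, h.trans hmk.symm⟩⟩
    obtain ⟨Z, hZ, hex⟩ := hφ.exists_exceptional _ _ hd ((hpφ.mem_dom_iff hv).2 hpv)
      ((hpφ.mem_dom_iff hw).2 hpw) heq
    induction Z using Projectivization.ind with | h u hu =>
    have hpu : p u = 0 := by
      by_contra h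
      exact hex ((hpφ.mem_dom_iff hu).2 h)
    obtain ⟨a, b, rfl⟩ := Submodule.mem_span_pair.1 ((mk_mem_join_iff hv hw hu).1 hZ)
    -- the exceptional point differs from the point of `w`, so the coefficient of `v` is nonzero
    have ha : a ≠ 0 := by
      rintro rfl
      rw [zero_smul, zero_add] at hu hpu
      have := hpφ.map_smul h0 b⁻¹ (b • w)
      rw [inv_smul_smul₀ (left_ne_zero_of_smul hu), hpu, Submodule.span_zero_singleton,
        Submodule.mem_bot] at this
      exact hpw this
    refine ⟨-(a⁻¹ * b), ?_⟩
    have := hpφ.map_smul h0 a⁻¹ (a • v + b • w)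
    rwa [hpu, Submodule.span_zero_singleton, Submodule.mem_bot, smul_add, inv_smul_smul₀ ha,
      smul_smul, ← sub_neg_eq_add, ← neg_smul] at this

/-- A triangle in the image cannot lie on the line joining two images. -/
theorem exists_notMem_span_pair (hpφ : Induces p φ) (htri : ContainsTriangle φ.ran) (v w : V) :
    ∃ x, p x ∉ Submodule.span K' {p v, p w} := by
  by_contra! hcon
  obtain ⟨A, hA, B, hB, C, hC, hABC⟩ := htri
  have key : ∀ Q ∈ φ.ran, Q ∈ (Submodule.span K' {p v, p w}).projectivization := by
    rintro Q ⟨X, hX⟩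
    induction X using Projectivization.ind with | h x hx =>
    obtain ⟨hpx, rfl⟩ := (hpφ x hx Q).1 hX
    exact (Submodule.mk_mem_projectivization_iff _ hpx).2 (hcon x)
  refine hABC ⟨(Submodule.span K' {p v, p w}).projectivization, ?_, ?_, ?_⟩
  · rw [OrderIso.apply_symm_apply]
    exact Module.Finite.span_of_finite _ (Set.toFinite _)
  · rw [OrderIso.apply_symm_apply]
    classical
    have h := finrank_span_finset_le_card (R := K') ({p v, p w} : Finset V')
    rw [Finset.coe_pair] at h
    exact h.trans Finset.card_le_two
  · rintro Q (rfl | rfl | rfl)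
    exacts [key _ hA, key _ hB, key _ hC]

theorem of_proportional (hpφ : Induces p φ) {f : V → V'}
    (hf : ∀ v, ∃ t : K', t ≠ 0 ∧ p v = t • f v) : Induces f φ := by
  intro v hv Q
  obtain ⟨t, ht, htv⟩ := hf v
  rw [hpφ v hv Q]
  constructor
  · rintro ⟨hpv, rfl⟩
    exact ⟨fun h => hpv (by rw [htv, h, smul_zero]),
      (Projectivization.mk_eq_mk_iff' K' _ _ _ _).2 ⟨t, htv.symm⟩⟩
  · rintro ⟨hfv, rfl⟩
    exact ⟨by rw [htv]; exact smul_ne_zero ht hfv,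
      (Projectivization.mk_eq_mk_iff' K' _ _ _ _).2 ⟨t⁻¹, by rw [htv, inv_smul_smul₀ ht]⟩⟩

/-- Mappings that induce the same mapping of points agree up to a scalar at each vector. -/
theorem exists_eq_smul {f g : V → V'} (hf : Induces f φ) (hg : Induces g φ) (hg0 : g 0 = 0)
    (v : V) : ∃ c : K', g v = c • f v := by
  by_cases hgv : g v = 0
  · exact ⟨0, by rw [hgv, zero_smul]⟩
  have hv : v ≠ 0 := fun h => hgv (h ▸ hg0)
  obtain ⟨_, h⟩ := (hf v hv _).1 ((hg v hv _).2 ⟨hgv, rfl⟩)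
  obtain ⟨c, hc⟩ := (Projectivization.mk_eq_mk_iff' K' _ _ _ _).1 h
  exact ⟨c, hc.symm⟩

end Induces

/-- Multiplying by `c` replaces the accompanying isomorphism `ζ` by `a ↦ c * ζ a * c⁻¹`. -/
theorem IsSemilinear.const_smul {f : V → V'} (hf : IsSemilinear K K' f) {c : K'} (hc : c ≠ 0) :
    IsSemilinear K K' fun v => c • f v := by
  obtain ⟨ζ, F, rfl⟩ := hf
  let ζ' : K ≃+* K' :=
    { ζ.toEquiv.trans ((Equiv.mulLeft₀ c hc).trans (Equiv.mulRight₀ c⁻¹ (inv_ne_zero hc))) with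
      map_mul' := fun a b => by simp [mul_assoc, hc]
      map_add' := fun a b => by simp [mul_add, add_mul] }
  have hζ' : ∀ a, ζ' a = c * ζ a * c⁻¹ := fun _ => rfl
  exact ⟨ζ', { toFun := fun v => c • F v
               map_add' := fun v w => by rw [map_add, smul_add]
               map_smul' := fun a v => by
                 rw [F.map_smulₛₗ, RingEquiv.coe_toRingHom, RingEquiv.coe_toRingHom, hζ', smul_smul,
                   smul_smul, inv_mul_cancel_right₀ hc] }, rfl⟩

end Coordinates

end ProjGeom

/-! ### Existence and uniqueness of the inducing semilinear mapping -/

theorem corollary1 {K : Type*} {V : Type*} {K' : Type*} {V' : Type*}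
    [DivisionRing K] [AddCommGroup V] [Module K V]
    [DivisionRing K'] [AddCommGroup V'] [Module K' V']
    (φ : ℙ K V →. ℙ K' V') (hφ : ProjGeom.IsLinearMapping φ)
    (htri : ProjGeom.ContainsTriangle φ.ran) :
    ∃ f : V → V', ProjGeom.IsSemilinear K K' f ∧ ProjGeom.Induces f φ ∧
      ∀ g : V → V', (ProjGeom.IsSemilinear K K' g ∧ ProjGeom.Induces g φ) ↔
        ∃ c : K', c ≠ 0 ∧ ∀ v : V, g v = c • f v := by
  obtain ⟨p, hp0, hp⟩ := ProjGeom.exists_induces φ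
  obtain ⟨f, hf, hpf⟩ := (hp.isLineMap hφ hp0).exists_semilinear hp0
    (hp.exists_notMem_span_pair htri)
  have hfφ : ProjGeom.Induces f φ := hp.of_proportional hpf
  refine ⟨f, hf, hfφ, fun g => ⟨?_, ?_⟩⟩
  · rintro ⟨⟨ζ, G, rfl⟩, hg⟩
    have hadd : ∀ v w, f (v + w) = f v + f w := by
      obtain ⟨-, F, rfl⟩ := hf
      exact map_add F
    obtain ⟨c, hc⟩ := ProjGeom.exists_eq_smul_of_forall_mem_span (K' := K') hadd G.map_add
      (hfφ.exists_eq_smul hg (map_zero G))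
      fun v => by simpa using hfφ.exists_notMem_span_pair htri v v
    refine ⟨c, ?_, hc⟩
    rintro rfl
    obtain ⟨x, hx⟩ := hg.exists_notMem_span_pair htri 0 0
    exact hx (by rw [hc x, zero_smul]; exact zero_mem _)
  · rintro ⟨c, hc, hg⟩
    obtain rfl : g = fun v => c • f v := funext hg
    exact ⟨hf.const_smul hc, hfφ.of_proportional fun v =>
      ⟨c⁻¹, inv_ne_zero hc, (inv_smul_smul₀ hc _).symm⟩⟩
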